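/- Let $(\Omega,\mathcal F,\mathbb P)$ be a complete probability space with a filtration $\mathbb F=(\mathcal F_s)_{s\ge 0}$ satisfying the usual conditions, and let $W$ be a standard Brownian motion with respect to $\mathbb F$. Let $\mu\in\mathbb R$, $\sigma>0$, $r>0$, $T\in(0,\infty)$ and $0\le\eta<\kappa$. For $x\ge 0$ let $S(x):=\inf\{s\ge 0:\ x+\mu s+\sigma W_s=0\}$ (with $\inf\emptyset=+\infty$), and for $h\ge 0$ let $\Lambda(h)$ be the set of all $\mathbb F$-stopping times with values in $[0,h]$ a.s. For $(t,x)\in[0,T]\times[0,\infty)$ put $$u(t,x):=\sup_{\tau\in\Lambda(T-t)}\mathbb E\Big[e^{-r\tau}\eta\,\mathbf 1_{\{\tau<S(x)\}}+e^{-rS(x)}\kappa\,\mathbf 1_{\{\tau\ge S(x)\}}\Big].$$ Then these expectations and the supremum are well defined and finite, and (i) $u(T,x)=\eta$ for every $x>0$, and $u(t,0)=\kappa$ for every $t\in[0,T]$; (ii) $t\mapsto u(t,x)$ is nonincreasing on $[0,T]$ for every $x>0$; (iii) $x\mapsto u(t,x)$ is nonincreasing on $[0,\infty)$ for every $t\in[0,T]$.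 -/

import Mathlib

open MeasureTheory ProbabilityTheory
open scoped NNReal

namespace DividendStopping

variable {Ω : Type*} {mΩ : MeasurableSpace Ω}

/-- The usual conditions on a filtered probability space: the filtration is right-continuous and
its initial σ-algebra contains every set of outer measure zero. -/
structure UsualConditions (𝓕 : Filtration ℝ≥0 mΩ) (P : Measure Ω) : Prop where
  rightContinuous : 𝓕.IsRightContinuous
  null_measurable : ∀ A : Set Ω, P A = 0 → MeasurableSet[𝓕 0] A

/-- `W` is a standard Brownian motion with respect to the filtration `𝓕`: it has the law of
Brownian motion and almost surely continuous paths, it is adapted to `𝓕`, and the increment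
`W t - W s` is independent of `𝓕 s` for all `s ≤ t`. -/
structure IsFilteredBrownian (W : ℝ≥0 → Ω → ℝ) (𝓕 : Filtration ℝ≥0 mΩ) (P : Measure Ω) : Prop
    extends IsBrownianReal W P where
  adapted : Adapted 𝓕 W
  indep_increment : ∀ s t : ℝ≥0, s ≤ t →
    Indep (MeasurableSpace.comap (fun ω ↦ W t ω - W s ω) inferInstance) (𝓕 s) P

/-- The drifted Brownian motion `x + μ s + σ W_s`. -/
def driftedBM (μ σ : ℝ) (W : ℝ≥0 → Ω → ℝ) (x : ℝ) (s : ℝ≥0) (ω : Ω) : ℝ :=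
  x + μ * s + σ * W s ω

/-- The absorption time `S(x) = inf {s ≥ 0 : x + μ s + σ W_s = 0}`, equal to `⊤` when the path
never vanishes. -/
noncomputable def absorptionTime (μ σ : ℝ) (W : ℝ≥0 → Ω → ℝ) (x : ℝ) : Ω → WithTop ℝ≥0 :=
  hittingAfter (driftedBM μ σ W x) {0} 0

/-- The discount factor `e ^ (-r s)`, with the convention `e ^ (-∞) = 0`. -/
noncomputable def discount (r : ℝ) : WithTop ℝ≥0 → ℝ
  | ⊤ => 0
  | (s : ℝ≥0) => Real.exp (-r * s)

/-- `Λ(h)`: the stopping times of the filtration `𝓕` with values in `[0, h]` almost surely. -/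
def stoppingTimes (𝓕 : Filtration ℝ≥0 mΩ) (P : Measure Ω) (h : ℝ≥0) : Set (Ω → WithTop ℝ≥0) :=
  {τ | IsStoppingTime 𝓕 τ ∧ ∀ᵐ ω ∂P, τ ω ≤ (h : WithTop ℝ≥0)}

open scoped Classical in
/-- The reward `e ^ (-r τ) η 1_{τ < S(x)} + e ^ (-r S(x)) κ 1_{τ ≥ S(x)}` of stopping at `τ`. -/
noncomputable def reward (μ σ r η κ : ℝ) (W : ℝ≥0 → Ω → ℝ) (x : ℝ) (τ : Ω → WithTop ℝ≥0)
    (ω : Ω) : ℝ :=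
  discount r (τ ω) * η * (if τ ω < absorptionTime μ σ W x ω then 1 else 0)
    + discount r (absorptionTime μ σ W x ω) * κ *
      (if absorptionTime μ σ W x ω ≤ τ ω then 1 else 0)

/-- The set of expected rewards attained by the stopping times in `Λ(T - t)`. -/
noncomputable def expectedRewards (μ σ r η κ : ℝ) (T : ℝ≥0) (W : ℝ≥0 → Ω → ℝ)
    (𝓕 : Filtration ℝ≥0 mΩ) (P : Measure Ω) (t : ℝ≥0) (x : ℝ) : Set ℝ :=
  (fun τ ↦ ∫ ω, reward μ σ r η κ W x τ ω ∂P) '' stoppingTimes 𝓕 P (T - t)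

/-- The value function `u(t, x)` of the optimal stopping problem, meant for `0 ≤ t ≤ T` and
`0 ≤ x`. -/
noncomputable def value (μ σ r η κ : ℝ) (T : ℝ≥0) (W : ℝ≥0 → Ω → ℝ)
    (𝓕 : Filtration ℝ≥0 mΩ) (P : Measure Ω) (t : ℝ≥0) (x : ℝ) : ℝ :=
  sSup (expectedRewards μ σ r η κ T W 𝓕 P t x)

end DividendStopping

namespace DividendStopping

section Discount

variable {r : ℝ}

/-! Everything is a pathwise comparison, then integrated. Rewards lie in `[0, κ]`, so the supremum
is finite. A larger horizon admits more stopping times, giving monotonicity in time. In space, a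
lower start is absorbed earlier (`absorptionTime_mono`), and since `η ≤ κ` and discounting
decreases, earlier absorption pays at least as much for the same `τ` (`reward_le_reward`). On the
boundary the reward is a.s. independent of `τ`. -/

lemma discount_coe (r : ℝ) (s : ℝ≥0) : discount r (s : WithTop ℝ≥0) = Real.exp (-r * s) := rfl

lemma discount_zero (r : ℝ) : discount r 0 = 1 := by
  rw [← WithTop.coe_zero, discount_coe]; simp

lemma discount_nonneg (r : ℝ) (s : WithTop ℝ≥0) : 0 ≤ discount r s := by
  cases s with
  | top => exact le_rfl
  | coe s => exact (Real.exp_pos _).le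

lemma discount_antitone (hr : 0 ≤ r) : Antitone (discount r) := by
  intro s t hst
  cases t with
  | top => exact discount_nonneg r s
  | coe t =>
    lift s to ℝ≥0 using ne_top_of_le_ne_top WithTop.coe_ne_top hst
    have h : (s : ℝ) ≤ t := by exact_mod_cast hst
    rw [discount_coe, discount_coe, Real.exp_le_exp]
    nlinarith

lemma discount_le_one (hr : 0 ≤ r) (s : WithTop ℝ≥0) : discount r s ≤ 1 :=
  (discount_antitone hr zero_le).trans_eq (discount_zero r)

lemma measurable_discount (r : ℝ) : Measurable (discount r) :=
  WithTop.measurable_of_measurable_comp_coe <| by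
    simp_rw [discount_coe]; fun_prop

end Discount

/-! ### Absorption along a single continuous path -/

section Path

variable {Ω : Type*} {W : ℝ≥0 → Ω → ℝ} {μ σ x y : ℝ} {ω : Ω}

lemma continuous_driftedBM (hc : Continuous (W · ω)) :
    Continuous (fun s ↦ driftedBM μ σ W x s ω) := by
  unfold driftedBM; fun_prop

lemma driftedBM_zero (h0 : W 0 ω = 0) : driftedBM μ σ W x 0 ω = x := by
  simp [driftedBM, h0]

lemma absorptionTime_le {s : ℝ≥0} (hs : driftedBM μ σ W x s ω = 0) :
    absorptionTime μ σ W x ω ≤ s :=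
  hittingAfter_le_of_mem zero_le hs

/-- The zero set of a continuous path is closed, so a finite infimum is attained. -/
lemma driftedBM_eq_zero_of_absorptionTime_eq (hc : Continuous (W · ω)) {s : ℝ≥0}
    (hs : absorptionTime μ σ W x ω = s) : driftedBM μ σ W x s ω = 0 := by
  unfold absorptionTime hittingAfter at hs
  split_ifs at hs with h
  swap
  · exact absurd hs WithTop.top_ne_coe
  have hcl : IsClosed {i : ℝ≥0 | 0 ≤ i ∧ driftedBM μ σ W x i ω ∈ ({0} : Set ℝ)} := by
    simpa using isClosed_eq (continuous_driftedBM hc) continuous_const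
  have hmem := hcl.csInf_mem h (OrderBot.bddBelow _)
  rw [WithTop.coe_inj.mp hs] at hmem
  exact hmem.2

lemma absorptionTime_le_iff (hc : Continuous (W · ω)) (q : ℝ≥0) :
    absorptionTime μ σ W x ω ≤ q ↔ ∃ s ≤ q, driftedBM μ σ W x s ω = 0 := by
  constructor
  · intro h
    obtain ⟨s, hs⟩ := WithTop.ne_top_iff_exists.mp (ne_top_of_le_ne_top WithTop.coe_ne_top h)
    rw [← hs] at h
    exact ⟨s, by exact_mod_cast h, driftedBM_eq_zero_of_absorptionTime_eq hc hs.symm⟩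
  · rintro ⟨s, hsq, hs⟩
    exact (absorptionTime_le hs).trans (by exact_mod_cast hsq)

lemma absorptionTime_zero (h0 : W 0 ω = 0) : absorptionTime μ σ W 0 ω = 0 :=
  le_antisymm (absorptionTime_le (driftedBM_zero h0)) zero_le

lemma absorptionTime_pos (hc : Continuous (W · ω)) (h0 : W 0 ω = 0) (hx : x ≠ 0) :
    0 < absorptionTime μ σ W x ω := by
  refine zero_le.lt_of_ne fun h ↦ hx ?_
  rw [← driftedBM_eq_zero_of_absorptionTime_eq (s := 0) hc h.symm, driftedBM_zero h0]

/-- The two paths differ by the constant `y - x`: when the upper one vanishes, the lower is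
nonpositive, and having started at `x ≥ 0` it has already crossed zero. -/
lemma absorptionTime_mono (hc : Continuous (W · ω)) (h0 : W 0 ω = 0) (hx : 0 ≤ x) (hxy : x ≤ y) :
    absorptionTime μ σ W x ω ≤ absorptionTime μ σ W y ω := by
  cases hS : absorptionTime μ σ W y ω with
  | top => exact le_top
  | coe s =>
    have hs := driftedBM_eq_zero_of_absorptionTime_eq hc hS
    have hxs : driftedBM μ σ W x s ω ≤ 0 := by
      unfold driftedBM at hs ⊢; linarith
    obtain ⟨q, hq, hq0⟩ := intermediate_value_Icc' zero_le
      (continuous_driftedBM (μ := μ) (σ := σ) (x := x) hc).continuousOn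
      ⟨hxs, by rwa [driftedBM_zero h0]⟩
    exact (absorptionTime_le_iff hc s).2 ⟨q, hq.2, hq0⟩

/-- A continuous path is absorbed before time `q` exactly when it comes arbitrarily close to zero
along a countable dense set of times in `[0, q]`. -/
lemma absorptionTime_le_iff_denseSeq (hc : Continuous (W · ω)) (q : ℝ≥0) :
    absorptionTime μ σ W x ω ≤ q ↔ ∀ n : ℕ, ∃ k : ℕ,
      |driftedBM μ σ W x (min (TopologicalSpace.denseSeq ℝ≥0 k) q) ω| < 1 / (n + 1) := by
  have hX := continuous_driftedBM (μ := μ) (σ := σ) (x := x) hc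
  rw [absorptionTime_le_iff hc]
  constructor
  · rintro ⟨s, hsq, hs⟩ n
    have hopen : IsOpen {d : ℝ≥0 | |driftedBM μ σ W x (min d q) ω| < 1 / ((n : ℝ) + 1)} :=
      isOpen_lt (hX.comp (continuous_id.min continuous_const)).abs continuous_const
    have hmem : s ∈ {d : ℝ≥0 | |driftedBM μ σ W x (min d q) ω| < 1 / ((n : ℝ) + 1)} := by
      rw [Set.mem_ofPred_eq, min_eq_left hsq, hs, abs_zero]; positivity
    obtain ⟨_, hd, k, rfl⟩ :=
      (TopologicalSpace.denseRange_denseSeq ℝ≥0).inter_open_nonempty _ hopen ⟨s, hmem⟩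
    exact ⟨k, hd⟩
  · intro h
    -- The minimum of the modulus over `[0, q]` is attained and lies below every `1 / (n + 1)`, so
    -- it is zero.
    obtain ⟨s, hs, hmin⟩ := (isCompact_Icc (a := (0 : ℝ≥0)) (b := q)).exists_isMinOn
      ⟨0, le_rfl, zero_le⟩ hX.abs.continuousOn
    refine ⟨s, hs.2, abs_nonpos_iff.mp (le_of_forall_pos_le_add fun ε hε ↦ ?_)⟩
    obtain ⟨n, hn⟩ := exists_nat_one_div_lt hε
    obtain ⟨k, hk⟩ := h n
    have := hmin (show min (TopologicalSpace.denseSeq ℝ≥0 k) q ∈ Set.Icc 0 q from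
      ⟨zero_le, min_le_right _ _⟩)
    simp only [Set.mem_ofPred_eq] at this
    linarith

end Path

section Reward

variable {Ω : Type*} {W : ℝ≥0 → Ω → ℝ} {μ σ r η κ x y : ℝ} {τ : Ω → WithTop ℝ≥0} {ω : Ω}

lemma reward_of_lt (h : τ ω < absorptionTime μ σ W x ω) :
    reward μ σ r η κ W x τ ω = discount r (τ ω) * η := by
  simp [reward, h, h.not_ge]

lemma reward_of_le (h : absorptionTime μ σ W x ω ≤ τ ω) :
    reward μ σ r η κ W x τ ω = discount r (absorptionTime μ σ W x ω) * κ := by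
  simp [reward, h, h.not_gt]

lemma reward_nonneg (hη : 0 ≤ η) (hκ : 0 ≤ κ) : 0 ≤ reward μ σ r η κ W x τ ω := by
  rcases lt_or_ge (τ ω) (absorptionTime μ σ W x ω) with h | h
  · rw [reward_of_lt h]; exact mul_nonneg (discount_nonneg _ _) hη
  · rw [reward_of_le h]; exact mul_nonneg (discount_nonneg _ _) hκ

lemma reward_le (hr : 0 ≤ r) (hη : 0 ≤ η) (hκ : η ≤ κ) : reward μ σ r η κ W x τ ω ≤ κ := by
  rcases lt_or_ge (τ ω) (absorptionTime μ σ W x ω) with h | h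
  · rw [reward_of_lt h]
    exact (mul_le_of_le_one_left hη (discount_le_one hr _)).trans hκ
  · rw [reward_of_le h]
    exact mul_le_of_le_one_left (hη.trans hκ) (discount_le_one hr _)

/-- Being absorbed earlier can only increase the reward of a given stopping time. -/
lemma reward_le_reward (hr : 0 ≤ r) (hη : 0 ≤ η) (hκ : η ≤ κ)
    (hS : absorptionTime μ σ W x ω ≤ absorptionTime μ σ W y ω) :
    reward μ σ r η κ W y τ ω ≤ reward μ σ r η κ W x τ ω := by
  rcases lt_or_ge (τ ω) (absorptionTime μ σ W x ω) with hx | hx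
  · rw [reward_of_lt hx, reward_of_lt (hx.trans_le hS)]
  rw [reward_of_le hx]
  -- If only the path from `x` is absorbed by `τ`, it collects `κ ≥ η`, and no later than `τ`.
  rcases lt_or_ge (τ ω) (absorptionTime μ σ W y ω) with hy | hy
  · rw [reward_of_lt hy]
    exact mul_le_mul (discount_antitone hr hx) hκ hη (discount_nonneg _ _)
  · rw [reward_of_le hy]
    exact mul_le_mul_of_nonneg_right (discount_antitone hr hS) (hη.trans hκ)

lemma measurable_reward [MeasurableSpace Ω] (hS : Measurable (absorptionTime μ σ W x))
    (hτ : Measurable τ) : Measurable (reward μ σ r η κ W x τ) := by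
  unfold reward
  refine .add (.mul (((measurable_discount r).comp hτ).mul_const η) ?_)
    (.mul (((measurable_discount r).comp hS).mul_const κ) ?_)
  · exact .ite (measurableSet_lt hτ hS) measurable_const measurable_const
  · exact .ite (measurableSet_le hS hτ) measurable_const measurable_const

end Reward

/-! ### Measurability and passage to expectations -/

section Value

variable {Ω : Type*} {mΩ : MeasurableSpace Ω} {P : Measure Ω} {𝓕 : Filtration ℝ≥0 mΩ}
  {W : ℝ≥0 → Ω → ℝ} {μ σ r η κ x y : ℝ} {T t : ℝ≥0} {τ : Ω → WithTop ℝ≥0}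

lemma IsFilteredBrownian.measurable (hW : IsFilteredBrownian W 𝓕 P) (s : ℝ≥0) :
    Measurable (W s) :=
  (hW.adapted s).mono (𝓕.le s) le_rfl

lemma IsFilteredBrownian.ae_path (hW : IsFilteredBrownian W 𝓕 P) :
    ∀ᵐ ω ∂P, Continuous (W · ω) ∧ W 0 ω = 0 :=
  hW.cont.and hW.toIsBrownianReal.eval_zero_ae_eq_zero

/-- The countable description of absorption holds only on continuous paths, hence almost surely;
completeness absorbs the exceptional null set. -/
lemma measurable_absorptionTime [P.IsComplete] (hW : ∀ s, Measurable (W s))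
    (hc : ∀ᵐ ω ∂P, Continuous (W · ω)) : Measurable (absorptionTime μ σ W x) := by
  refine measurable_of_Iic fun a ↦ ?_
  cases a with
  | top => simp
  | coe q =>
    have hX (s : ℝ≥0) : Measurable (driftedBM μ σ W x s) := by
      have := hW s
      unfold driftedBM
      fun_prop
    have hA : MeasurableSet {ω | ∀ n : ℕ, ∃ k : ℕ,
        |driftedBM μ σ W x (min (TopologicalSpace.denseSeq ℝ≥0 k) q) ω| < 1 / (n + 1)} := by
      simp only [Set.ofPred_forall, Set.ofPred_exists]
      exact .iInter fun n ↦ .iUnion fun k ↦ measurableSet_lt (hX _).abs measurable_const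
    refine NullMeasurableSet.measurable_of_complete (μ := P) (hA.nullMeasurableSet.congr ?_)
    filter_upwards [hc] with ω hω
    exact propext (absorptionTime_le_iff_denseSeq hω q).symm

lemma integrable_reward [IsProbabilityMeasure P] [P.IsComplete] (hW : IsFilteredBrownian W 𝓕 P)
    (hr : 0 ≤ r) (hη : 0 ≤ η) (hκ : η ≤ κ) (hτ : IsStoppingTime 𝓕 τ) :
    Integrable (reward μ σ r η κ W x τ) P := by
  have hS := measurable_absorptionTime (μ := μ) (σ := σ) (x := x) hW.measurable
    (hW.ae_path.mono fun _ h ↦ h.1)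
  refine .of_bound (measurable_reward hS hτ.measurable').aestronglyMeasurable κ (.of_forall ?_)
  intro ω
  rw [Real.norm_of_nonneg (reward_nonneg hη (hη.trans hκ))]
  exact reward_le hr hη hκ

lemma zero_mem_stoppingTimes (h : ℝ≥0) : (fun _ ↦ 0) ∈ stoppingTimes 𝓕 P h :=
  ⟨isStoppingTime_const 𝓕 0, .of_forall fun _ ↦ zero_le⟩

lemma stoppingTimes_mono : Monotone (stoppingTimes 𝓕 P) := fun _ _ h _ hτ ↦
  ⟨hτ.1, hτ.2.mono fun _ hω ↦ hω.trans (WithTop.coe_le_coe.2 h)⟩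

lemma expectedRewards_nonempty : (expectedRewards μ σ r η κ T W 𝓕 P t x).Nonempty :=
  ⟨_, _, zero_mem_stoppingTimes _, rfl⟩

lemma bddAbove_expectedRewards [IsProbabilityMeasure P] [P.IsComplete]
    (hW : IsFilteredBrownian W 𝓕 P) (hr : 0 ≤ r) (hη : 0 ≤ η) (hκ : η ≤ κ) :
    BddAbove (expectedRewards μ σ r η κ T W 𝓕 P t x) := by
  refine ⟨κ, ?_⟩
  rintro _ ⟨τ, hτ, rfl⟩
  calc ∫ ω, reward μ σ r η κ W x τ ω ∂P ≤ ∫ _, κ ∂P :=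
        integral_mono (integrable_reward hW hr hη hκ hτ.1) (integrable_const κ)
          fun ω ↦ reward_le hr hη hκ
    _ = κ := by simp

lemma value_eq_of_forall {c : ℝ} [IsProbabilityMeasure P]
    (h : ∀ τ ∈ stoppingTimes 𝓕 P (T - t), reward μ σ r η κ W x τ =ᵐ[P] fun _ ↦ c) :
    value μ σ r η κ T W 𝓕 P t x = c := by
  have hset : expectedRewards μ σ r η κ T W 𝓕 P t x = {c} := by
    refine Set.eq_singleton_iff_nonempty_unique_mem.2 ⟨expectedRewards_nonempty, ?_⟩
    rintro _ ⟨τ, hτ, rfl⟩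
    simp [integral_congr_ae (h τ hτ)]
  rw [value, hset, csSup_singleton]

lemma value_terminal [IsProbabilityMeasure P] (hW : IsFilteredBrownian W 𝓕 P) (hx : x ≠ 0) :
    value μ σ r η κ T W 𝓕 P T x = η := by
  refine value_eq_of_forall fun τ hτ ↦ ?_
  filter_upwards [hW.ae_path, hτ.2] with ω ⟨hc, h0⟩ hle
  -- The horizon `T - T` is zero, which forces immediate stopping.
  have hτ0 : τ ω = 0 := le_antisymm (by simpa using hle) zero_le
  rw [reward_of_lt (hτ0 ▸ absorptionTime_pos hc h0 hx), hτ0, discount_zero, one_mul]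

lemma value_at_zero [IsProbabilityMeasure P] (hW : IsFilteredBrownian W 𝓕 P) :
    value μ σ r η κ T W 𝓕 P t 0 = κ := by
  refine value_eq_of_forall fun τ hτ ↦ ?_
  filter_upwards [hW.ae_path] with ω ⟨_, h0⟩
  have hS : absorptionTime μ σ W 0 ω = 0 := absorptionTime_zero h0
  rw [reward_of_le (hS ▸ zero_le), hS, discount_zero, one_mul]

lemma value_antitone_time [IsProbabilityMeasure P] [P.IsComplete]
    (hW : IsFilteredBrownian W 𝓕 P) (hr : 0 ≤ r) (hη : 0 ≤ η) (hκ : η ≤ κ) :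
    Antitone fun t ↦ value μ σ r η κ T W 𝓕 P t x := fun _ _ hst ↦
  csSup_le_csSup (bddAbove_expectedRewards hW hr hη hκ) expectedRewards_nonempty
    (Set.image_mono (stoppingTimes_mono (tsub_le_tsub_left hst T)))

lemma value_antitoneOn_space [IsProbabilityMeasure P] [P.IsComplete]
    (hW : IsFilteredBrownian W 𝓕 P) (hr : 0 ≤ r) (hη : 0 ≤ η) (hκ : η ≤ κ) :
    AntitoneOn (fun x ↦ value μ σ r η κ T W 𝓕 P t x) (Set.Ici 0) := by
  intro x hx y _ hxy
  refine csSup_le expectedRewards_nonempty ?_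
  rintro _ ⟨τ, hτ, rfl⟩
  refine le_csSup_of_le (bddAbove_expectedRewards hW hr hη hκ) ⟨τ, hτ, rfl⟩ ?_
  refine integral_mono_ae (integrable_reward hW hr hη hκ hτ.1)
    (integrable_reward hW hr hη hκ hτ.1) ?_
  filter_upwards [hW.ae_path] with ω ⟨hc, h0⟩
  exact reward_le_reward hr hη hκ (absorptionTime_mono hc h0 hx hxy)

end Value

end DividendStopping

open DividendStopping in
theorem proposition5p1 {Ω : Type*} [mΩ : MeasurableSpace Ω] (P : Measure Ω)
    [IsProbabilityMeasure P] [P.IsComplete] (𝓕 : Filtration ℝ≥0 mΩ) (h𝓕 : UsualConditions 𝓕 P)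
    (W : ℝ≥0 → Ω → ℝ) (hW : IsFilteredBrownian W 𝓕 P)
    (μ σ r η κ : ℝ) (hσ : 0 < σ) (hr : 0 < r) (hη : 0 ≤ η) (hκ : η < κ)
    (T : ℝ≥0) (hT : 0 < T) :
    -- the optimal stopping problem is well posed
    (∀ t ∈ Set.Icc 0 T, ∀ x : ℝ, 0 ≤ x →
      (∀ τ ∈ stoppingTimes 𝓕 P (T - t), Integrable (reward μ σ r η κ W x τ) P) ∧
      IsLUB (expectedRewards μ σ r η κ T W 𝓕 P t x) (value μ σ r η κ T W 𝓕 P t x)) ∧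
    -- (i)
    ((∀ x : ℝ, 0 < x → value μ σ r η κ T W 𝓕 P T x = η) ∧
      (∀ t ∈ Set.Icc 0 T, value μ σ r η κ T W 𝓕 P t 0 = κ)) ∧
    -- (ii)
    (∀ x : ℝ, 0 < x → AntitoneOn (fun t ↦ value μ σ r η κ T W 𝓕 P t x) (Set.Icc 0 T)) ∧
    -- (iii)
    (∀ t ∈ Set.Icc 0 T, AntitoneOn (fun x ↦ value μ σ r η κ T W 𝓕 P t x) (Set.Ici 0)) :=
  ⟨fun _ _ _ _ ↦ ⟨fun _ hτ ↦ integrable_reward hW hr.le hη hκ.le hτ.1,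
      isLUB_csSup expectedRewards_nonempty (bddAbove_expectedRewards hW hr.le hη hκ.le)⟩,
    ⟨fun _ hx ↦ value_terminal hW hx.ne', fun _ _ ↦ value_at_zero hW⟩,
    fun _ _ ↦ (value_antitone_time hW hr.le hη hκ.le).antitoneOn _,
    fun _ _ ↦ value_antitoneOn_space hW hr.le hη hκ.le⟩
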